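/- Let $m,N,N'\ge 1$ be integers with $m\ge N$, let $X\in\mathbb{R}^{m\times N}$ have full column rank $N$ with columns $X_1,\dots,X_N$, let $W\in\mathbb{R}^{N\times N'}$ and let $\delta>0$. For $z\in\mathbb{R}$ let $\mathcal{Q}_{\mathrm{stoc}}(z)$ be the random variable that equals $(\lfloor z/\delta\rfloor+1)\delta$ with probability $z/\delta-\lfloor z/\delta\rfloor$ and $\lfloor z/\delta\rfloor\delta$ otherwise. OPTQ with stochastic rounding on the infinite grid $\delta\mathbb{Z}$ and regularization $\lambda=0$ does the following. Let $(X^\top X)^{-1}=LL^\top$ be the Cholesky decomposition, with $L$ lower triangular with positive diagonal. For each column $w$ of $W$ (in parallel) put $w^{(0)}=w$, and for $t=1,\dots,N$ set $$q_t=\mathcal{Q}_{\mathrm{stoc}}\bigl(w^{(t-1)}_t\bigr),\qquad w^{(t)}_i=w^{(t-1)}_i+\bigl(q_t-w^{(t-1)}_t\bigr)\frac{L_{it}}{L_{tt}}\quad(i\ge t+1),$$ where within a column each call of $\mathcal{Q}_{\mathrm{stoc}}$ uses fresh randomness. The quantized version of $w$ is $q=(q_1,\dots,q_N)^\top$, and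 $Q\in(\delta\mathbb{Z})^{N\times N'}$ is the random matrix of the quantized columns; nothing is assumed about the dependence between different columns of $Q$. Write $P_{X_{\ge j+1}^\perp}$ for the orthogonal projection of $\mathbb{R}^m$ onto the orthogonal complement of $\mathrm{span}\{X_{j+1},\dots,X_N\}$. Then for all $p,p'>0$: (1) for every column $w$ of $W$ with quantized version $q$, $$\|Xw-Xq\|_\infty\le\delta\sqrt{2\pi p\log N}\;\max_{1\le j\le N}\|P_{X_{\ge j+1}^\perp}X_j\|_2\quad\text{with probability at least } 1-\frac{\sqrt2\,m}{N^p};$$ (2) $$\max_{i,j}|(XW-XQ)_{ij}|\le\delta\sqrt{2\pi(p\log N+p'\log N')}\;\max_{1\le j\le N}\|P_{X_{\ge j+1}^\perp}X_j\|_2\quad\text{with probability at least } 1-\frac{\sqrt2\,m}{N^p\,{N'}^{p'-1}}.$$ -/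

import Mathlib

open Matrix MeasureTheory ProbabilityTheory

noncomputable section

namespace OPTQ

/-- `L` is a Cholesky factor of `A`: `L` is lower triangular with positive diagonal, and
`A = L Lᵀ`. -/
structure IsCholeskyFactor {N : ℕ} (A L : Matrix (Fin N) (Fin N) ℝ) : Prop where
  lower : ∀ i j, i < j → L i j = 0
  diag_pos : ∀ i, 0 < L i i
  eq_mul : A = L * Lᵀ

/-- A positive definite matrix has a Cholesky factor. -/
theorem exists_isCholeskyFactor {N : ℕ} {A : Matrix (Fin N) (Fin N) ℝ} (hA : A.PosDef) :
    ∃ L, IsCholeskyFactor A L := by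
  have htri : (LDL.lowerInv hA).BlockTriangular OrderDual.toDual :=
    fun i j hij => LDL.lowerInv_triangular hA hij
  have htri' : (LDL.lower hA).BlockTriangular OrderDual.toDual :=
    blockTriangular_inv_of_blockTriangular htri
  have hdet : IsUnit (LDL.lowerInv hA).det :=
    (Matrix.isUnit_iff_isUnit_det _).1 (isUnit_of_invertible _)
  have hinj : Function.Injective (LDL.lowerInv hA)ᴴ.mulVec := by
    apply Matrix.mulVec_injective_of_isUnit
    rw [Matrix.isUnit_iff_isUnit_det, Matrix.det_conjTranspose]
    exact hdet.star
  have hDpd : (LDL.diag hA).PosDef := by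
    have h := hA.conjTranspose_mul_mul_same hinj
    rw [LDL.diag_eq_lowerInv_conj]
    simpa using h
  have hd : ∀ i, 0 < LDL.diagEntries hA i := by
    intro i
    have := hDpd.diag_pos (i := i)
    simpa [LDL.diag] using this
  have hdetL : (LDL.lower hA).det ≠ 0 := by
    rw [LDL.lower, Matrix.det_nonsing_inv]
    exact (hdet.ringInverse).ne_zero
  have hne : ∀ i, LDL.lower hA i i ≠ 0 := by
    rw [Matrix.det_of_isLowerTriangular _ htri'] at hdetL
    intro i
    exact (Finset.prod_ne_zero_iff.1 hdetL) i (Finset.mem_univ i)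
  -- rescale the columns by `√D` and by the signs of the diagonal entries
  let s : Fin N → ℝ := fun i => SignType.sign (LDL.lower hA i i) * √(LDL.diagEntries hA i)
  have hs : ∀ i, s i * s i = LDL.diagEntries hA i := by
    intro i
    have h1 : ((SignType.sign (LDL.lower hA i i) : SignType) : ℝ) *
        ((SignType.sign (LDL.lower hA i i) : SignType) : ℝ) = 1 := by
      rcases lt_or_gt_of_ne (hne i) with h | h <;> simp [h]
    calc s i * s i = (((SignType.sign (LDL.lower hA i i) : SignType) : ℝ) *
          ((SignType.sign (LDL.lower hA i i) : SignType) : ℝ)) *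
          (√(LDL.diagEntries hA i) * √(LDL.diagEntries hA i)) := by simp only [s]; ring
      _ = _ := by rw [h1, Real.mul_self_sqrt (hd i).le, one_mul]
  refine ⟨LDL.lower hA * Matrix.diagonal s, ?_, ?_, ?_⟩
  · intro i j hij
    rw [Matrix.mul_diagonal, htri' hij, zero_mul]
  · intro i
    rw [Matrix.mul_diagonal]
    have h2 : LDL.lower hA i i * ((SignType.sign (LDL.lower hA i i) : SignType) : ℝ)
        = |LDL.lower hA i i| := self_mul_sign _
    simp only [s]
    rw [← mul_assoc, h2]
    exact mul_pos (abs_pos.2 (hne i)) (Real.sqrt_pos.2 (hd i))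
  · conv_lhs => rw [← LDL.lower_conj_diag hA]
    rw [Matrix.transpose_mul, Matrix.diagonal_transpose, Matrix.mul_assoc, Matrix.mul_assoc,
      ← Matrix.mul_assoc (Matrix.diagonal s), Matrix.diagonal_mul_diagonal,
      conjTranspose_eq_transpose_of_trivial]
    simp only [hs, LDL.diag]

open Classical in
/-- The Cholesky factor of `A`, with value `0` if there is none. -/
def cholesky {N : ℕ} (A : Matrix (Fin N) (Fin N) ℝ) : Matrix (Fin N) (Fin N) ℝ :=
  if h : ∃ L, IsCholeskyFactor A L then h.choose else 0

theorem isCholeskyFactor_cholesky {N : ℕ} {A : Matrix (Fin N) (Fin N) ℝ} (hA : A.PosDef) :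
    IsCholeskyFactor A (cholesky A) := by
  have h := exists_isCholeskyFactor hA
  rw [cholesky, dif_pos h]
  exact h.choose_spec

/-- The law of the unbiased stochastic scalar quantizer on the grid `δℤ`, applied to `z`: it is
`(⌊z/δ⌋ + 1) δ` with probability `z/δ - ⌊z/δ⌋` and `⌊z/δ⌋ δ` with probability
`1 - (z/δ - ⌊z/δ⌋)`. -/
def stochRound (δ z : ℝ) : PMF ℝ :=
  (PMF.ofFintype
    (fun up : Bool => cond up (ENNReal.ofReal (z / δ - ⌊z / δ⌋))
      (ENNReal.ofReal (1 - (z / δ - ⌊z / δ⌋))))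
    (by
      have h0 : 0 ≤ z / δ - ⌊z / δ⌋ := sub_nonneg.2 (Int.floor_le _)
      have h1 : 0 ≤ 1 - (z / δ - ⌊z / δ⌋) := by linarith [Int.lt_floor_add_one (z / δ)]
      rw [Fintype.sum_bool, cond_true, cond_false, ← ENNReal.ofReal_add h0 h1]
      simp)).map
    (fun up : Bool => cond up (((⌊z / δ⌋ : ℝ) + 1) * δ) ((⌊z / δ⌋ : ℝ) * δ))

/-- One pass through the inner loop: the `t`-th coordinate of the current vector `v` is replaced
by its quantized value `q`, the coordinates after `t` are updated with the `t`-th column of `L`,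
and those before `t` (already quantized) stay. -/
def step {N : ℕ} (L : Matrix (Fin N) (Fin N) ℝ) (t : Fin N) (v : Fin N → ℝ) (q : ℝ) :
    Fin N → ℝ :=
  fun i => if i < t then v i else if i = t then q else v i + (q - v t) * (L i t / L t t)

/-- The law of the vector `(q₁, …, q_t, w⁽ᵗ⁾_{t+1}, …, w⁽ᵗ⁾_N)` after the first `t` passes through
the inner loop (all `N` of them if `t ≥ N`), started at `w`; each call of the quantizer uses fresh
randomness. -/
def state {N : ℕ} (δ : ℝ) (L : Matrix (Fin N) (Fin N) ℝ) (w : Fin N → ℝ) :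
    ℕ → PMF (Fin N → ℝ)
  | 0 => PMF.pure w
  | t + 1 => (state δ L w t).bind fun v =>
      if h : t < N then (stochRound δ (v ⟨t, h⟩)).map (step L ⟨t, h⟩ v) else PMF.pure v

/-- The law of the output `q` of OPTQ with stochastic rounding on the grid `δℤ`, calibration data
`X` and regularization parameter `lam`, on the single column `w`. -/
def column {m N : ℕ} (δ lam : ℝ) (X : Matrix (Fin m) (Fin N) ℝ) (w : Fin N → ℝ) :
    PMF (Fin N → ℝ) :=
  state δ (cholesky (Xᵀ * X + lam • (1 : Matrix (Fin N) (Fin N) ℝ))⁻¹) w N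

/-- The random matrix `Q` on the probability space `(Ω, P)` is an output of OPTQ with stochastic
rounding on the layer `W`: each of its columns is an output of the column loop on the
corresponding column of `W`. The columns are processed in parallel; they may use independent or
shared random bits, so nothing is prescribed about their dependence. -/
def IsOutput {Ω : Type*} [MeasurableSpace Ω] (P : Measure Ω) {m N N' : ℕ} (δ lam : ℝ)
    (X : Matrix (Fin m) (Fin N) ℝ) (W : Matrix (Fin N) (Fin N') ℝ)
    (Q : Ω → Matrix (Fin N) (Fin N') ℝ) : Prop :=
  ∀ j, HasLaw (fun ω => (Q ω).col j) (column δ lam X (W.col j)).toMeasure P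

/-- The column `X_j` as a vector of the Euclidean space `ℝᵐ`. -/
def eucCol {m N : ℕ} (X : Matrix (Fin m) (Fin N) ℝ) (j : Fin N) : EuclideanSpace ℝ (Fin m) :=
  WithLp.toLp 2 (X.col j)

/-- `P_{X_{≥ j+1}^⊥} X_j`: the orthogonal projection of `X_j` onto the orthogonal complement of
the span of the later columns. -/
def residual {m N : ℕ} (X : Matrix (Fin m) (Fin N) ℝ) (j : Fin N) : EuclideanSpace ℝ (Fin m) :=
  (Submodule.span ℝ (eucCol X '' Set.Ioi j))ᗮ.starProjection (eucCol X j)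

end OPTQ

end

/-!
Let `L` be the Cholesky factor of `(Xᵀ X)⁻¹`. One pass of the loop changes the state by
`(q_t - w_t) / L_tt` times the `t`-th column of `L` (`dotProduct_step`), so the error is

  `X q - X w = ∑ t, ε_t • r_t`,  with `ε_t` the `t`-th rounding error and `r_t = X L e_t / L_tt`.

Two facts about this sum are needed.

* Given the past, `ε_t` is centred and takes two values at distance `δ`, so by Hoeffding's lemma its
  conditional moment generating function at `a` is at most `exp (a² δ² / 8)`. Multiplying these bounds
  along the loop (`tsum_state_exp_le`), the `i`-th coordinate of the error is sub-Gaussian with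
  variance proxy `δ² / 4 * ∑ t, (r_t)_i²`.
* The columns of `X L` are orthonormal, because `Lᵀ Xᵀ X L = 1`, and `Xᵀ X L = (Lᵀ)⁻¹` is upper
  triangular. Hence `r_t` is the projection of `X_t` onto the orthogonal complement of the later columns
  (`residual_eq`), and Bessel's inequality gives `∑ t, (r_t)_i² ≤ M²`, where `M` is the largest norm
  of a residual.

A Chernoff bound then shows that a coordinate of the error exceeds `δ √(2 π x) M` with probability at
most `2 exp (-4 π x)`, and `min 1 (2 exp (-4 π x)) ≤ √2 exp (-x)` (`column_tail`). Both claims follow by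
union bounds, over the `m` coordinates of one column with `x = p log N`, and over all `m N'` entries
with `x = p log N + p' log N'`.
-/

open OPTQ

namespace OPTQ

/-! ### Moment generating functions of the rounding errors -/

/-- Expectations along a `PMF.bind` are iterated expectations. -/
theorem tsum_bind_mul {α β : Type*} (μ : PMF α) (κ : α → PMF β) (g : β → ENNReal) :
    ∑' b, μ.bind κ b * g b = ∑' a, μ a * ∑' b, κ a b * g b := by
  simp_rw [PMF.bind_apply, ← ENNReal.tsum_mul_right, ← ENNReal.tsum_mul_left]
  rw [ENNReal.tsum_comm]
  simp_rw [mul_assoc]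

theorem tsum_pure_mul {α : Type*} (a : α) (g : α → ENNReal) :
    ∑' b, PMF.pure a b * g b = g a := by
  rw [tsum_eq_single a]
  · simp
  · intro b hb
    simp [hb]

theorem tsum_map_mul {α β : Type*} (μ : PMF α) (f : α → β) (g : β → ENNReal) :
    ∑' b, μ.map f b * g b = ∑' a, μ a * g (f a) := by
  rw [PMF.map, tsum_bind_mul]
  exact tsum_congr fun a => congrArg _ (tsum_pure_mul (f a) g)

/-- Hoeffding's lemma for a centred Bernoulli variable with success probability `f`. -/
theorem bernoulli_exp_le {f : ℝ} (h0 : 0 ≤ f) (h1 : f ≤ 1) (a : ℝ) :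
    f * Real.exp ((1 - f) * a) + (1 - f) * Real.exp (-f * a) ≤ Real.exp (a ^ 2 / 8) := by
  have h1' : 0 ≤ 1 - f := sub_nonneg.2 h1
  let μ : PMF Bool := PMF.ofFintype
    (fun up : Bool => cond up (ENNReal.ofReal f) (ENNReal.ofReal (1 - f)))
    (by rw [Fintype.sum_bool, cond_true, cond_false, ← ENNReal.ofReal_add h0 h1']; simp)
  let Y : Bool → ℝ := fun up => cond up 1 0
  have hsum (g : Bool → ℝ) : ∫ b, g b ∂μ.toMeasure = f * g true + (1 - f) * g false := by
    rw [PMF.integral_eq_sum, Fintype.sum_bool]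
    simp [μ, PMF.ofFintype_apply, ENNReal.toReal_ofReal h0, ENNReal.toReal_ofReal h1']
  have hY : ∀ᵐ b ∂μ.toMeasure, Y b ∈ Set.Icc (0 : ℝ) 1 :=
    Filter.Eventually.of_forall fun b => by cases b <;> simp [Y]
  have h := (hasSubgaussianMGF_of_mem_Icc (μ := μ.toMeasure)
    (Measurable.of_discrete (f := Y)).aemeasurable hY).mgf_le a
  rw [mgf, hsum, hsum] at h
  simp only [Y, cond_true, cond_false] at h
  convert h using 2
  · ring_nf
  · ring_nf
  · simp; ring

/-- The rounding error at `z` is centred and takes two values at distance `|δ|`, so it is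
sub-Gaussian with variance proxy `δ² / 4`. -/
theorem tsum_stochRound_exp_le {δ : ℝ} (hδ : δ ≠ 0) (z a : ℝ) :
    ∑' q, stochRound δ z q * ENNReal.ofReal (Real.exp (a * (q - z))) ≤
      ENNReal.ofReal (Real.exp ((a * δ) ^ 2 / 8)) := by
  have h0 : 0 ≤ z / δ - ⌊z / δ⌋ := sub_nonneg.2 (Int.floor_le _)
  have h1 : z / δ - ⌊z / δ⌋ ≤ 1 := by linarith [Int.lt_floor_add_one (z / δ)]
  have h1' : 0 ≤ 1 - (z / δ - ⌊z / δ⌋) := sub_nonneg.2 h1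
  rw [stochRound, tsum_map_mul, tsum_bool]
  simp only [PMF.ofFintype_apply, cond_true, cond_false]
  rw [← ENNReal.ofReal_mul h0, ← ENNReal.ofReal_mul h1', ← ENNReal.ofReal_add (by positivity)
    (by positivity), add_comm]
  refine ENNReal.ofReal_le_ofReal (le_trans (le_of_eq ?_) (bernoulli_exp_le h0 h1 (a * δ)))
  congr 3
  · field_simp
    ring
  · field_simp
    ring

/-- Since `L` is lower triangular, one pass adds to the state the multiple `(q - v t) / L t t` of
the whole `t`-th column of `L`. -/
theorem dotProduct_step {N : ℕ} {L : Matrix (Fin N) (Fin N) ℝ}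
    (hL : ∀ i j, i < j → L i j = 0) (t : Fin N) (ht : L t t ≠ 0) (c v : Fin N → ℝ) (q : ℝ) :
    c ⬝ᵥ step L t v q = c ⬝ᵥ v + (c ᵥ* L) t / L t t * (q - v t) := by
  have h : step L t v q = v + ((q - v t) / L t t) • L.col t := by
    ext i
    simp only [step, Pi.add_apply, Pi.smul_apply, smul_eq_mul, col_apply]
    split_ifs with h1 h2
    · simp [hL _ _ h1]
    · subst h2; field_simp; ring
    · ring
  rw [h, dotProduct_add, dotProduct_smul, smul_eq_mul]
  have : c ⬝ᵥ L.col t = (c ᵥ* L) t := rfl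
  rw [this]
  ring

/-- A linear functional `c` of the state is a martingale whose `k`-th increment is `(c L)_k / L_kk`
times the `k`-th rounding error; conditioning on the past one pass at a time bounds its moment
generating function. -/
theorem tsum_state_exp_le {N : ℕ} {δ : ℝ} (hδ : δ ≠ 0) {L : Matrix (Fin N) (Fin N) ℝ}
    (hL : ∀ i j, i < j → L i j = 0) (hd : ∀ t, L t t ≠ 0) (c w : Fin N → ℝ) (s : ℝ) (t : ℕ) :
    ∑' v, state δ L w t v * ENNReal.ofReal (Real.exp (s * (c ⬝ᵥ v - c ⬝ᵥ w))) ≤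
      ENNReal.ofReal (Real.exp ((s * δ) ^ 2 / 8 *
        ∑ k : Fin N with k.val < t, ((c ᵥ* L) k / L k k) ^ 2)) := by
  induction t with
  | zero =>
    rw [state, tsum_pure_mul]
    simp
  | succ t ih =>
    rw [state, tsum_bind_mul]
    by_cases h : t < N
    · set k : Fin N := ⟨t, h⟩
      set r := (c ᵥ* L) k / L k k
      have hsum : ∑ k : Fin N with k.val < t + 1, ((c ᵥ* L) k / L k k) ^ 2 =
          r ^ 2 + ∑ k : Fin N with k.val < t, ((c ᵥ* L) k / L k k) ^ 2 := by
        have : ({k : Fin N | k.val < t + 1} : Finset (Fin N)) =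
            insert k ({k : Fin N | k.val < t} : Finset (Fin N)) := by
          ext i
          simp [k, Fin.ext_iff]
          omega
        rw [this, Finset.sum_insert (by simp [k])]
      have hstep (v : Fin N → ℝ) :
          ∑' b, (stochRound δ (v k)).map (step L k v) b *
              ENNReal.ofReal (Real.exp (s * (c ⬝ᵥ b - c ⬝ᵥ w))) ≤
            ENNReal.ofReal (Real.exp (s * (c ⬝ᵥ v - c ⬝ᵥ w))) *
              ENNReal.ofReal (Real.exp ((s * r * δ) ^ 2 / 8)) := by
        rw [tsum_map_mul]
        refine le_trans (le_of_eq ?_)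
          (mul_le_mul_right (tsum_stochRound_exp_le hδ (v k) (s * r)) _)
        rw [← ENNReal.tsum_mul_left]
        refine tsum_congr fun q => ?_
        rw [dotProduct_step hL k (hd k), mul_left_comm, ← ENNReal.ofReal_mul (Real.exp_nonneg _),
          ← Real.exp_add]
        congr 3
        simp only [r]
        ring
      simp only [h, dif_pos]
      calc _ ≤ ∑' v, state δ L w t v * ENNReal.ofReal (Real.exp (s * (c ⬝ᵥ v - c ⬝ᵥ w))) *
              ENNReal.ofReal (Real.exp ((s * r * δ) ^ 2 / 8)) := by
            refine ENNReal.tsum_le_tsum fun v => ?_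
            rw [mul_assoc]
            exact mul_le_mul_right (hstep v) _
        _ ≤ _ := by
            rw [ENNReal.tsum_mul_right, hsum]
            refine (mul_le_mul_left ih _).trans (le_of_eq ?_)
            rw [← ENNReal.ofReal_mul (Real.exp_nonneg _), ← Real.exp_add]
            congr 2
            ring
    · have hsum : ({k : Fin N | k.val < t + 1} : Finset (Fin N)) =
          ({k : Fin N | k.val < t} : Finset (Fin N)) := by
        ext i
        have := i.isLt
        simp
        omega
      simp only [h, dif_neg, not_false_eq_true, tsum_pure_mul, hsum]
      exact ih

/-! ### Sub-Gaussian tails -/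

/-- The Chernoff bound. -/
theorem toOuterMeasure_lt_le {V : Type*} (μ : PMF V) (g : V → ℝ) {K a : ℝ} (hK : 0 < K)
    (ha : 0 ≤ a)
    (h : ∀ s, ∑' v, μ v * ENNReal.ofReal (Real.exp (s * g v)) ≤
      ENNReal.ofReal (Real.exp (s ^ 2 * K / 2))) :
    μ.toOuterMeasure {v | a < g v} ≤ ENNReal.ofReal (Real.exp (-(a ^ 2 / (2 * K)))) := by
  -- the minimizer of `s² K / 2 - s a`
  set s := a / K
  have hs : 0 ≤ s := div_nonneg ha hK.le
  rw [PMF.toOuterMeasure_apply]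
  calc _ ≤ ∑' v, μ v * ENNReal.ofReal (Real.exp (s * g v)) *
          ENNReal.ofReal (Real.exp (-(s * a))) := by
        refine ENNReal.tsum_le_tsum fun v => ?_
        by_cases hv : v ∈ {v | a < g v}
        swap
        · rw [Set.indicator_of_notMem hv]
          exact zero_le
        rw [Set.indicator_of_mem hv, mul_assoc, ← ENNReal.ofReal_mul (Real.exp_nonneg _), ← Real.exp_add]
        refine le_mul_of_one_le_right' (ENNReal.one_le_ofReal.2 (Real.one_le_exp ?_))
        have : s * a ≤ s * g v := mul_le_mul_of_nonneg_left (le_of_lt hv) hs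
        linarith
    _ ≤ _ := by
        rw [ENNReal.tsum_mul_right]
        refine (mul_le_mul_left (h s) _).trans (le_of_eq ?_)
        rw [← ENNReal.ofReal_mul (Real.exp_nonneg _), ← Real.exp_add]
        congr 2
        simp only [s]
        field_simp
        ring

theorem toOuterMeasure_lt_abs_le {V : Type*} (μ : PMF V) (g : V → ℝ) {K a : ℝ} (hK : 0 < K)
    (ha : 0 ≤ a)
    (h : ∀ s, ∑' v, μ v * ENNReal.ofReal (Real.exp (s * g v)) ≤
      ENNReal.ofReal (Real.exp (s ^ 2 * K / 2))) :
    μ.toOuterMeasure {v | a < |g v|} ≤ ENNReal.ofReal (2 * Real.exp (-(a ^ 2 / (2 * K)))) := by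
  have hset : {v | a < |g v|} = {v | a < g v} ∪ {v | a < -g v} := by
    ext v
    simp [lt_abs]
  rw [hset, two_mul, ENNReal.ofReal_add (Real.exp_nonneg _) (Real.exp_nonneg _)]
  refine (measure_union_le _ _).trans (add_le_add (toOuterMeasure_lt_le μ g hK ha h)
    (toOuterMeasure_lt_le μ (fun v => -g v) hK ha fun s => ?_))
  simpa using h (-s)

/-- Either the Gaussian tail has enough room in the exponent to absorb the constant, or the
right-hand side is at least `1`. -/
theorem min_one_two_mul_exp_le {x : ℝ} (hx : 0 ≤ x) :
    min 1 (2 * Real.exp (-(4 * Real.pi * x))) ≤ √2 * Real.exp (-x) := by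
  have h2 : √2 * √2 = 2 := Real.mul_self_sqrt zero_le_two
  rcases le_total (Real.exp x) √2 with h | h
  · refine (min_le_left _ _).trans ?_
    rw [Real.exp_neg, ← div_eq_mul_inv, one_le_div (Real.exp_pos _)]
    exact h
  · refine (min_le_right _ _).trans ?_
    have hexp : Real.exp (-(4 * Real.pi * x)) ≤ Real.exp (-x) * Real.exp (-x) := by
      rw [← Real.exp_add, Real.exp_le_exp]
      nlinarith [Real.pi_gt_three]
    have h' : √2 * Real.exp (-x) ≤ 1 := by
      rw [Real.exp_neg, ← div_eq_mul_inv, div_le_one (Real.exp_pos _)]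
      exact h
    calc 2 * Real.exp (-(4 * Real.pi * x))
        ≤ 2 * (Real.exp (-x) * Real.exp (-x)) := by gcongr
      _ = (√2 * Real.exp (-x)) * (√2 * Real.exp (-x)) := by rw [mul_mul_mul_comm, h2]
      _ ≤ _ := mul_le_of_le_one_left (by positivity) h'

/-! ### Geometry of the Cholesky factor -/

theorem posDef_gram_inv {m N : ℕ} {X : Matrix (Fin m) (Fin N) ℝ} (hX : X.rank = N) :
    ((Xᵀ * X)⁻¹).PosDef := by
  have hinj : Function.Injective X.mulVec := by
    rw [mulVec_injective_iff, linearIndependent_iff_card_eq_finrank_span, Fintype.card_fin]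
    exact hX.symm.trans X.rank_eq_finrank_span_cols
  have h := Matrix.PosDef.conjTranspose_mul_self X hinj
  rw [conjTranspose_eq_transpose_of_trivial] at h
  exact h.inv

section Factor

variable {m N : ℕ} {X : Matrix (Fin m) (Fin N) ℝ} {L : Matrix (Fin N) (Fin N) ℝ}

theorem transpose_mul_gram_mul (hG : (Xᵀ * X).det ≠ 0)
    (hL : IsCholeskyFactor (Xᵀ * X)⁻¹ L) : Lᵀ * (Xᵀ * X * L) = 1 := by
  apply mul_eq_one_comm.1
  rw [Matrix.mul_assoc, ← hL.eq_mul]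
  exact Matrix.mul_nonsing_inv _ (isUnit_iff_ne_zero.2 hG)

/-- The columns of `X L` are orthonormal. -/
theorem orthonormal_mul_factor (hG : (Xᵀ * X).det ≠ 0)
    (hL : IsCholeskyFactor (Xᵀ * X)⁻¹ L) : (X * L)ᵀ * (X * L) = 1 := by
  rw [← transpose_mul_gram_mul hG hL, transpose_mul]
  simp only [Matrix.mul_assoc]

/-- The `t`-th column of `X L` is orthogonal to the later columns of `X`: the matrix `Xᵀ X L` is the
inverse of `Lᵀ`, hence upper triangular. -/
theorem transpose_mul_mul_factor_apply (hG : (Xᵀ * X).det ≠ 0)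
    (hL : IsCholeskyFactor (Xᵀ * X)⁻¹ L) {j t : Fin N} (h : t < j) :
    (Xᵀ * (X * L)) j t = 0 := by
  have h1 := transpose_mul_gram_mul hG hL
  have h2 : (Lᵀ).BlockTriangular id := fun i j hij => hL.lower j i hij
  have := invertibleOfLeftInverse _ _ (mul_eq_one_comm.1 h1)
  have h3 := blockTriangular_inv_of_blockTriangular h2
  rw [Matrix.inv_eq_right_inv h1, Matrix.mul_assoc] at h3
  exact h3 h

/-- The residuals are the columns of `X L`, scaled by the diagonal of `L`: the `t`-th column of
`X L` is `L t t • X_t` plus a combination of later columns of `X`, and is orthogonal to the latter. -/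
theorem residual_eq (hG : (Xᵀ * X).det ≠ 0)
    (hL : IsCholeskyFactor (Xᵀ * X)⁻¹ L) (t : Fin N) :
    residual X t = WithLp.toLp 2 ((L t t)⁻¹ • (X * L).col t) := by
  have hd : L t t ≠ 0 := (hL.diag_pos t).ne'
  have hcol : (X * L).col t = L t t • X.col t + ∑ i ∈ Finset.Ioi t, L i t • X.col i := by
    ext k
    rw [col_apply, Matrix.mul_apply,
      ← Finset.sum_subset (Finset.subset_univ (insert t (Finset.Ioi t))) fun i _ hi => ?_,
      Finset.sum_insert (by simp)]
    · simp [mul_comm]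
    · simp only [Finset.mem_insert, Finset.mem_Ioi, not_or, not_lt] at hi
      rw [hL.lower i t (lt_of_le_of_ne hi.2 hi.1), mul_zero]
  refine Submodule.eq_starProjection_of_mem_orthogonal ?_ ?_
  · rw [Submodule.mem_orthogonal]
    intro u hu
    induction hu using Submodule.span_induction with
    | mem u hu =>
      obtain ⟨j, hj, rfl⟩ := hu
      have h := transpose_mul_mul_factor_apply hG hL (Set.mem_Ioi.1 hj)
      rw [Matrix.mul_apply] at h
      simp only [transpose_apply] at h
      simp only [eucCol, WithLp.toLp_smul, inner_smul_right]
      rw [PiLp.inner_apply]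
      simp [mul_comm, h]
    | zero => simp
    | add u v _ _ hu hv => rw [inner_add_left, hu, hv, add_zero]
    | smul a u _ hu => rw [inner_smul_left, hu, mul_zero]
  · refine Submodule.le_orthogonal_orthogonal _ ?_
    have hdiff : eucCol X t - WithLp.toLp 2 ((L t t)⁻¹ • (X * L).col t) =
        -∑ i ∈ Finset.Ioi t, ((L t t)⁻¹ * L i t) • eucCol X i := by
      rw [hcol, smul_add, smul_smul, inv_mul_cancel₀ hd, one_smul, Finset.smul_sum]
      simp only [eucCol, WithLp.toLp_add, WithLp.toLp_sum, smul_smul, WithLp.toLp_smul]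
      abel
    rw [hdiff]
    refine Submodule.neg_mem _ (Submodule.sum_mem _ fun i hi => Submodule.smul_mem _ _
      (Submodule.subset_span ⟨i, ?_, rfl⟩))
    simpa using hi

theorem norm_residual (hG : (Xᵀ * X).det ≠ 0)
    (hL : IsCholeskyFactor (Xᵀ * X)⁻¹ L) (t : Fin N) :
    ‖residual X t‖ = (L t t)⁻¹ := by
  have hpos := inv_pos.2 (hL.diag_pos t)
  have h : ∑ k, (X * L) k t ^ 2 = 1 := by
    have := congrFun (congrFun (orthonormal_mul_factor hG hL) t) t
    rw [Matrix.mul_apply, Matrix.one_apply_eq] at this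
    simpa [sq] using this
  rw [residual_eq hG hL, WithLp.toLp_smul, norm_smul, EuclideanSpace.norm_eq, Real.norm_eq_abs,
    abs_of_pos hpos]
  simp [h]

end Factor

/-- Bessel's inequality for a standard basis vector and the orthonormal columns of `B`. With
`d = (B Bᵀ)_ii`, idempotence of `B Bᵀ` gives `d² ≤ ∑ k, (B Bᵀ)_ik² = d`. -/
theorem sum_sq_row_le_one {m N : ℕ} {B : Matrix (Fin m) (Fin N) ℝ} (hB : Bᵀ * B = 1)
    (i : Fin m) : ∑ t, B i t ^ 2 ≤ 1 := by
  set d := ∑ t, B i t ^ 2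
  have hd : (B * Bᵀ) i i = d := by
    rw [Matrix.mul_apply]
    simp [d, sq]
  have hidem : (B * Bᵀ) * (B * Bᵀ) = B * Bᵀ := by
    rw [Matrix.mul_assoc, ← Matrix.mul_assoc Bᵀ, hB, Matrix.one_mul]
  have hsum : ∑ k, (B * Bᵀ) i k ^ 2 = d := by
    rw [← hd]
    conv_rhs => rw [← hidem, Matrix.mul_apply]
    refine Finset.sum_congr rfl fun k _ => ?_
    have : (B * Bᵀ) k i = (B * Bᵀ) i k := by
      simp [Matrix.mul_apply, mul_comm]
    rw [this, sq]
  have hle : d ^ 2 ≤ d := by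
    conv_rhs => rw [← hsum]
    rw [← hd]
    exact Finset.single_le_sum (f := fun k => (B * Bᵀ) i k ^ 2) (fun k _ => sq_nonneg _)
      (Finset.mem_univ i)
  nlinarith

/-! ### The tail of one coordinate of the error -/

/-- The `i`-th coordinate of the error is sub-Gaussian with variance proxy
`δ² / 4 * ∑ k, (residual X k)_i²`, and orthogonality of the residuals bounds that sum by the largest
squared norm of a residual. -/
theorem column_tail {m N : ℕ} (hN : 0 < N) {X : Matrix (Fin m) (Fin N) ℝ} (hX : X.rank = N)
    {δ : ℝ} (hδ : 0 < δ) (w : Fin N → ℝ) (i : Fin m) {x : ℝ} (hx : 0 ≤ x) :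
    (column δ 0 X w).toOuterMeasure
        {q | δ * √(2 * Real.pi * x) * (⨆ k, ‖residual X k‖) < |(X *ᵥ w - X *ᵥ q) i|} ≤
      ENNReal.ofReal (√2 * Real.exp (-x)) := by
  have hpd := posDef_gram_inv hX
  have hG : (Xᵀ * X).det ≠ 0 := by
    intro h0
    have := hpd.det_pos
    rw [Matrix.det_nonsing_inv, h0] at this
    simp at this
  set L := cholesky (Xᵀ * X)⁻¹ with hLdef
  have hL : IsCholeskyFactor (Xᵀ * X)⁻¹ L := isCholeskyFactor_cholesky hpd
  set M := ⨆ k, ‖residual X k‖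
  have hM (k : Fin N) : (L k k)⁻¹ ≤ M :=
    norm_residual hG hL k ▸ le_ciSup (Set.finite_range fun k => ‖residual X k‖).bddAbove k
  have hMpos : 0 < M := (inv_pos.2 (hL.diag_pos ⟨0, hN⟩)).trans_le (hM _)
  have hsum : ∑ k : Fin N with k.val < N, ((X i ᵥ* L) k / L k k) ^ 2 ≤ M ^ 2 := by
    rw [Finset.filter_true_of_mem fun k _ => k.isLt]
    calc _ ≤ ∑ k, M ^ 2 * (X * L) i k ^ 2 := by
          refine Finset.sum_le_sum fun k _ => ?_
          have hk : (X i ᵥ* L) k = (X * L) i k := rfl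
          rw [hk, div_eq_mul_inv, mul_pow, mul_comm]
          have := hM k
          have := inv_pos.2 (hL.diag_pos k)
          gcongr
      _ ≤ M ^ 2 := by
          rw [← Finset.mul_sum]
          exact mul_le_of_le_one_right (sq_nonneg _)
            (sum_sq_row_le_one (orthonormal_mul_factor hG hL) i)
  have hcol : column δ 0 X w = state δ L w N := by simp [column, hLdef]
  have hmgf (s : ℝ) : ∑' v, column δ 0 X w v *
      ENNReal.ofReal (Real.exp (s * (X i ⬝ᵥ v - X i ⬝ᵥ w))) ≤
        ENNReal.ofReal (Real.exp (s ^ 2 * (δ ^ 2 * M ^ 2 / 4) / 2)) := by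
    rw [hcol]
    refine (tsum_state_exp_le hδ.ne' hL.lower (fun t => (hL.diag_pos t).ne') (X i) w s N).trans ?_
    refine ENNReal.ofReal_le_ofReal (Real.exp_le_exp.2 ?_)
    calc _ ≤ (s * δ) ^ 2 / 8 * M ^ 2 := by gcongr
      _ = _ := by ring
  have htail := toOuterMeasure_lt_abs_le (column δ 0 X w) (fun v => X i ⬝ᵥ v - X i ⬝ᵥ w)
    (K := δ ^ 2 * M ^ 2 / 4) (a := δ * √(2 * Real.pi * x) * M) (by positivity) (by positivity) hmgf
  have hexp : (δ * √(2 * Real.pi * x) * M) ^ 2 / (2 * (δ ^ 2 * M ^ 2 / 4)) =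
      4 * Real.pi * x := by
    rw [mul_pow, mul_pow, Real.sq_sqrt (by positivity)]
    field_simp
  rw [hexp] at htail
  have hset : {q | δ * √(2 * Real.pi * x) * M < |(X *ᵥ w - X *ᵥ q) i|} =
      {q | δ * √(2 * Real.pi * x) * M < |X i ⬝ᵥ q - X i ⬝ᵥ w|} := by
    ext q
    simp only [Set.mem_ofPred_eq]
    rw [abs_sub_comm]
    rfl
  rw [hset]
  have hone : (column δ 0 X w).toOuterMeasure
      {q | δ * √(2 * Real.pi * x) * M < |X i ⬝ᵥ q - X i ⬝ᵥ w|} ≤ ENNReal.ofReal 1 := by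
    rw [ENNReal.ofReal_one]
    refine (measure_mono (Set.subset_univ _)).trans_eq ?_
    rw [PMF.toOuterMeasure_apply, Set.indicator_univ, PMF.tsum_coe]
  refine (le_min hone htail).trans ?_
  rw [← ENNReal.ofReal_min]
  exact ENNReal.ofReal_le_ofReal (min_one_two_mul_exp_le hx)

theorem IsOutput.tail {Ω : Type*} [MeasurableSpace Ω] {P : Measure Ω} {m N N' : ℕ} (hN : 0 < N)
    {X : Matrix (Fin m) (Fin N) ℝ} (hX : X.rank = N) {W : Matrix (Fin N) (Fin N') ℝ}
    {δ : ℝ} (hδ : 0 < δ) {Q : Ω → Matrix (Fin N) (Fin N') ℝ} (hQ : IsOutput P δ 0 X W Q)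
    (i : Fin m) (j : Fin N') {x : ℝ} (hx : 0 ≤ x) :
    P {ω | ¬ |(X *ᵥ W.col j - X *ᵥ (Q ω).col j) i| ≤
        δ * √(2 * Real.pi * x) * ⨆ k, ‖residual X k‖} ≤
      ENNReal.ofReal (√2 * Real.exp (-x)) := by
  simp only [not_le]
  have hmeas : MeasurableSet {q : Fin N → ℝ | δ * √(2 * Real.pi * x) * (⨆ k, ‖residual X k‖) <
      |(X *ᵥ W.col j - X *ᵥ q) i|} := by
    refine measurableSet_lt measurable_const (Continuous.measurable ?_)
    simp only [Pi.sub_apply, mulVec]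
    fun_prop
  rw [(hQ j).measure_eq hmeas, PMF.toMeasure_apply_eq_toOuterMeasure_apply _ hmeas]
  exact column_tail hN hX hδ _ i hx

/-! ### Union bounds -/

/-- The union bound; no measurability of the events is needed. -/
theorem one_sub_card_mul_le_measureReal_forall {Ω ι : Type*} [MeasurableSpace Ω] [Fintype ι]
    (P : Measure Ω) [IsProbabilityMeasure P] (A : ι → Ω → Prop) {ε : ℝ} (hε : 0 ≤ ε)
    (h : ∀ k, P {ω | ¬ A k ω} ≤ ENNReal.ofReal ε) :
    1 - Fintype.card ι * ε ≤ P.real {ω | ∀ k, A k ω} := by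
  have hcover : (Set.univ : Set Ω) = {ω | ∀ k, A k ω} ∪ ⋃ k, {ω | ¬ A k ω} := by
    ext ω
    simp only [Set.mem_univ, Set.mem_union, Set.mem_ofPred_eq, Set.mem_iUnion, true_iff]
    rw [← not_forall]
    exact em _
  have h1 : (1 : ℝ) ≤ P.real {ω | ∀ k, A k ω} + P.real (⋃ k, {ω | ¬ A k ω}) := by
    rw [← probReal_univ (μ := P), hcover]
    exact measureReal_union_le _ _
  have h2 : P.real (⋃ k, {ω | ¬ A k ω}) ≤ Fintype.card ι * ε :=
    calc _ ≤ ∑ k, P.real {ω | ¬ A k ω} := measureReal_iUnion_fintype_le _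
      _ ≤ ∑ _k : ι, ε := Finset.sum_le_sum fun k _ => ENNReal.toReal_le_of_le_ofReal hε (h k)
      _ = _ := by simp
  linarith

end OPTQ

theorem mainTheorem5 {m N N' : ℕ} (hN : 0 < N) (hN' : 0 < N')
    (X : Matrix (Fin m) (Fin N) ℝ) (hmN : N ≤ m) (hX : X.rank = N)
    (W : Matrix (Fin N) (Fin N') ℝ) (δ : ℝ) (hδ : 0 < δ)
    {Ω : Type*} [MeasurableSpace Ω] (P : Measure Ω) [IsProbabilityMeasure P]
    (Q : Ω → Matrix (Fin N) (Fin N') ℝ) (hQ : OPTQ.IsOutput P δ 0 X W Q)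
    (p p' : ℝ) (hp : 0 < p) (hp' : 0 < p') :
    (∀ j : Fin N',
      1 - √2 * m / (N : ℝ) ^ p ≤
        P.real {ω | ‖X *ᵥ W.col j - X *ᵥ (Q ω).col j‖ ≤
          δ * √(2 * Real.pi * p * Real.log N) * ⨆ k : Fin N, ‖OPTQ.residual X k‖}) ∧
    1 - √2 * m / ((N : ℝ) ^ p * (N' : ℝ) ^ (p' - 1)) ≤
      P.real {ω | ∀ (i : Fin m) (j : Fin N'), |(X * W - X * Q ω) i j| ≤
        δ * √(2 * Real.pi * (p * Real.log N + p' * Real.log N')) *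
          ⨆ k : Fin N, ‖OPTQ.residual X k‖} := by
  have hN0 : (0 : ℝ) < N := by exact_mod_cast hN
  have hN'0 : (0 : ℝ) < N' := by exact_mod_cast hN'
  have hlog : 0 ≤ p * Real.log N := mul_nonneg hp.le (Real.log_natCast_nonneg N)
  have hlog' : 0 ≤ p' * Real.log N' := mul_nonneg hp'.le (Real.log_natCast_nonneg N')
  have hpow : (N : ℝ) ^ p = Real.exp (p * Real.log N) := by
    rw [Real.rpow_def_of_pos hN0, mul_comm]
  have hpow' : (N' : ℝ) ^ p' = Real.exp (p' * Real.log N') := by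
    rw [Real.rpow_def_of_pos hN'0, mul_comm]
  have hsup : 0 ≤ ⨆ k : Fin N, ‖residual X k‖ := Real.iSup_nonneg fun _ => norm_nonneg _
  constructor
  · intro j
    have h := one_sub_card_mul_le_measureReal_forall P
      (fun (i : Fin m) ω => |(X *ᵥ W.col j - X *ᵥ (Q ω).col j) i| ≤
        δ * √(2 * Real.pi * (p * Real.log N)) * ⨆ k, ‖residual X k‖)
      (by positivity) fun i => hQ.tail hN hX hδ i j hlog
    have hc : √2 * m / (N : ℝ) ^ p =
        Fintype.card (Fin m) * (√2 * Real.exp (-(p * Real.log N))) := by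
      rw [hpow, Real.exp_neg, Fintype.card_fin]
      ring
    rw [hc]
    simp_rw [pi_norm_le_iff_of_nonneg (show 0 ≤ δ * √(2 * Real.pi * p * Real.log N) *
      ⨆ k : Fin N, ‖residual X k‖ by positivity), Real.norm_eq_abs, mul_assoc (2 * Real.pi)]
    exact h
  · have h := one_sub_card_mul_le_measureReal_forall P
      (fun (ij : Fin m × Fin N') ω => |(X *ᵥ W.col ij.2 - X *ᵥ (Q ω).col ij.2) ij.1| ≤
        δ * √(2 * Real.pi * (p * Real.log N + p' * Real.log N')) * ⨆ k, ‖residual X k‖)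
      (by positivity) fun ij => hQ.tail hN hX hδ ij.1 ij.2 (add_nonneg hlog hlog')
    have hc : √2 * m / ((N : ℝ) ^ p * (N' : ℝ) ^ (p' - 1)) =
        Fintype.card (Fin m × Fin N') *
          (√2 * Real.exp (-(p * Real.log N + p' * Real.log N'))) := by
      rw [Real.rpow_sub_one hN'0.ne', hpow, hpow', Real.exp_neg, Real.exp_add,
        Fintype.card_prod, Fintype.card_fin, Fintype.card_fin, Nat.cast_mul]
      field_simp
    rw [hc]
    simp only [Prod.forall] at h
    exact h
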